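/- Let $K$ be a number field with algebraic closure $\bar K$, let $S$ be a finite set of primes of $K$ containing all infinite primes, and let $K_S$ be the group of $S$-units of $K$. Let $l$ be a prime number such that $K$ contains no primitive $l$-th root of unity, and let $m$ be a power of $l$. Let $L/K$ be a Galois extension inside $\bar K$ whose Galois group is an $l$-group, put $\tilde K = K(\mu_m)$ and $\tilde L = L(\mu_m)$, and let $M \subseteq \bar K$ be an abelian extension of $L$ containing $\tilde L$. For a field $E$ with $K \subseteq E \subseteq \bar K$, write $E(\sqrt[m]{K_S})$ for the field generated over $E$ by all $m$-th roots in $\bar K$ of all elements of $K_S$. Then there are isomorphisms $$\mathrm{Gal}(\tilde K(\sqrt[m]{K_S})/\tilde K) \overset{f_1}{\cong} \mathrm{Gal}(\tilde L(\sqrt[m]{K_S})/\tilde L) \overset{f_2}{\cong} \mathrm{Gal}(M(\sqrt[m]{K_S})/M) \cong (\mathbb{Z}/m\mathbb{Z})^{u}, \qquad u = |S| - 1,$$ where $f_1$ and $f_2$ are the inverses of the maps given by restriction of automorphisms. -/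

import Mathlib

open NumberField IsDedekindDomain

namespace SUnitKummer

/-- The primes (places) of a number field: the infinite ones and the finite ones. -/
abbrev Place (K : Type*) [Field K] [NumberField K] : Type _ :=
  InfinitePlace K ⊕ HeightOneSpectrum (𝓞 K)

/-- The group `K_S` of `S`-units of `K`: the elements of `Kˣ` that are units at every finite
prime outside `S`. -/
noncomputable def sUnits {K : Type*} [Field K] [NumberField K] (S : Finset (Place K)) :
    Subgroup Kˣ :=
  Set.unit {p : HeightOneSpectrum (𝓞 K) | (Sum.inr p : Place K) ∈ S} K

variable {K Ω : Type*} [Field K] [Field Ω] [Algebra K Ω]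

/-- The field `E(μ_m)` inside `Ω`. -/
noncomputable def adjoinMu (m : ℕ) (E : IntermediateField K Ω) : IntermediateField K Ω :=
  (IntermediateField.adjoin E {ζ : Ω | ζ ^ m = 1}).restrictScalars K

/-- The extension of `E` generated inside `Ω` by all `m`-th roots of all `S`-units of `K`. -/
noncomputable def adjoinRoots [NumberField K] (S : Finset (Place K)) (m : ℕ)
    (E : IntermediateField K Ω) : IntermediateField E Ω :=
  IntermediateField.adjoin E {x : Ω | ∃ a ∈ sUnits S, x ^ m = algebraMap K Ω (a : K)}

end SUnitKummer

/-!
The Galois groups are computed by Kummer theory, and everything reduces to one descent statement: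
an `S`-unit `a` of `K` which is an `m`-th power in `M` is already the `m`-th power of an `S`-unit
(`exists_sUnits_pow_eq`).

Let `F` be one of `K(μ_m)`, `L(μ_m)`, `M`. Sending `σ` to the character `a ↦ σ(√[m]a) / √[m]a`
embeds the Galois group of `F(√[m]K_S)` over `F` into the dual of `K_S / K_S ^ m`
(`kummerMap_injective`). An element of this quotient killed by the whole image has an `m`-th root
in `F`, so by the descent statement it is trivial, and duality for finite abelian groups shows that
the embedding is onto (`kummerMap_bijective`). The three Galois groups are thus identified with one
and the same dual group, and automorphisms with equal characters agree wherever both are defined;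
this says that the resulting isomorphisms invert restriction
(`exists_mulEquiv_of_bijective_kummerMap`).

For the descent, `L` contains no primitive `l`-th root of unity, because an element of `l`-power
order of the Galois group acts trivially on `μ_l`
(`not_exists_isPrimitiveRoot_of_isPGroup`). The extension `M / L` is abelian, and an argument of
Schinzel brings an `m`-th power in `M` down to `L` (`exists_pow_eq_of_isAbelianGalois`). Finally
`L` contains no nontrivial `m`-th root of unity, so an `m`-th root of `a` in `L` is fixed by the
Galois group of `L / K` (`exists_pow_eq_of_isGalois`).

The structure of `K_S / K_S ^ m` comes from Dirichlet's unit theorem and the finiteness of the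
class group: the exponents at the finite primes of `S` map `K_S` onto a subgroup of full rank, with
kernel the unit group (`finrank_additive_unit`). As `K_S` has no `l`-torsion, the quotient is free
over `ℤ/m` of rank `|S| - 1` (`exists_surjective_sUnits_ker_eq`).
-/

namespace SUnitKummer

/-! ### The rank of the group of `S`-units -/

/-- Some power of a prime ideal is principal, so there is an element of `K` whose divisor is a
nonzero multiple of a given finite prime. -/
theorem exists_units_valuation_ne_one (K : Type*) [Field K] [NumberField K]
    (p : HeightOneSpectrum (𝓞 K)) :
    ∃ x : Kˣ, p.valuation K (x : K) ≠ 1 ∧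
      ∀ q : HeightOneSpectrum (𝓞 K), q ≠ p → q.valuation K (x : K) = 1 := by
  classical
  obtain ⟨h, hpos, r, hr⟩ : ∃ h : ℕ, 0 < h ∧ ∃ r : 𝓞 K, p.asIdeal ^ h = Ideal.span {r} := by
    refine ⟨Fintype.card (ClassGroup (𝓞 K)), Fintype.card_pos, ?_⟩
    have hp0 : p.asIdeal ∈ nonZeroDivisors (Ideal (𝓞 K)) := mem_nonZeroDivisors_of_ne_zero p.ne_bot
    have h1 : ClassGroup.mk0 (⟨p.asIdeal, hp0⟩ ^ Fintype.card (ClassGroup (𝓞 K))) = 1 := by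
      rw [map_pow, pow_card_eq_one]
    rw [ClassGroup.mk0_eq_one_iff] at h1
    obtain ⟨r, hr⟩ := h1.principal
    exact ⟨r, by simpa using hr⟩
  have hr0 : r ≠ 0 := by
    rintro rfl
    rw [Set.singleton_zero, Ideal.span_zero] at hr
    exact p.ne_bot (eq_zero_of_pow_eq_zero hr)
  have hmem (q : HeightOneSpectrum (𝓞 K)) : r ∈ q.asIdeal ↔ q = p := by
    rw [← Ideal.span_singleton_le_iff_mem, ← hr]
    constructor
    · intro hle
      have := q.isPrime.le_of_pow_le hle
      exact (HeightOneSpectrum.ext (p.isMaximal.eq_of_le q.isPrime.ne_top this)).symm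
    · rintro rfl
      exact Ideal.pow_le_self hpos.ne'
  refine ⟨Units.mk0 (r : K) (by simpa using hr0), ?_, fun q hq => ?_⟩
  · rw [Units.val_mk0]
    have := (p.valuation_lt_one_iff_mem (K := K) r).2 ((hmem p).2 rfl)
    exact this.ne
  · rw [Units.val_mk0]
    exact (HeightOneSpectrum.valuation_eq_one_iff_notMem q (K := K)).2 fun h => hq ((hmem q).1 h)

section Rank

variable (K : Type*) [Field K] [NumberField K] (T : Finset (HeightOneSpectrum (𝓞 K)))

/-- The exponents of a `T`-unit at the primes of `T`, as a `ℤ`-linear map on the additive version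
of the group of `T`-units. -/
noncomputable def valuationVector :
    Additive ((T : Set (HeightOneSpectrum (𝓞 K))).unit K) →ₗ[ℤ] (T → ℤ) :=
  LinearMap.pi fun p =>
    (MonoidHom.toAdditiveLeft
      (p.1.valuationOfNeZero.comp
        ((T : Set (HeightOneSpectrum (𝓞 K))).unit K).subtype)).toIntLinearMap

theorem valuationVector_apply_eq_zero_iff
    (x : (T : Set (HeightOneSpectrum (𝓞 K))).unit K) (p : T) :
    valuationVector K T (Additive.ofMul x) p = 0 ↔ p.1.valuation K ((x : Kˣ) : K) = 1 := by
  rw [← HeightOneSpectrum.valuationOfNeZero_eq]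
  change Multiplicative.toAdd (p.1.valuationOfNeZero (x : Kˣ)) = 0 ↔ _
  rw [← toAdd_one, Multiplicative.toAdd.injective.eq_iff]
  exact WithZero.coe_inj.symm

/-- The embedding of the units of the ring of integers into the `T`-units. -/
noncomputable def unitsToUnit :
    Additive (𝓞 K)ˣ →ₗ[ℤ] Additive ((T : Set (HeightOneSpectrum (𝓞 K))).unit K) :=
  (MonoidHom.toAdditive ((Units.map (algebraMap (𝓞 K) K : 𝓞 K →* K)).codRestrict
    ((T : Set (HeightOneSpectrum (𝓞 K))).unit K) fun x v _ => by
      rw [← HeightOneSpectrum.valuationOfNeZero_eq, HeightOneSpectrum.valuation_of_unit_eq]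
      rfl)).toIntLinearMap

theorem unitsToUnit_injective : Function.Injective (unitsToUnit K T) := by
  intro x y h
  have h' : algebraMap (𝓞 K) K (x.toMul : 𝓞 K) = algebraMap (𝓞 K) K (y.toMul : 𝓞 K) :=
    congrArg (fun z => ((z.toMul : Kˣ) : K)) h
  exact Additive.toMul.injective (Units.ext (FaithfulSMul.algebraMap_injective _ _ h'))

theorem range_unitsToUnit :
    LinearMap.range (unitsToUnit K T) = LinearMap.ker (valuationVector K T) := by
  ext x
  induction x using Additive.rec with | _ x
  constructor
  · rintro ⟨y, hy⟩
    rw [LinearMap.mem_ker]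
    ext p
    rw [Pi.zero_apply, valuationVector_apply_eq_zero_iff]
    have : (x : Kˣ) = Units.map (algebraMap (𝓞 K) K : 𝓞 K →* K) y.toMul :=
      (congrArg (fun z => (z.toMul : Kˣ)) hy).symm
    rw [this, ← HeightOneSpectrum.valuationOfNeZero_eq, HeightOneSpectrum.valuation_of_unit_eq]
    rfl
  · intro hx
    have hval (v : HeightOneSpectrum (𝓞 K)) : v.valuation K ((x : Kˣ) : K) = 1 := by
      by_cases hv : v ∈ T
      · exact (valuationVector_apply_eq_zero_iff K T x ⟨v, hv⟩).1
          (congrFun (LinearMap.mem_ker.1 hx) _)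
      · exact x.2 v hv
    obtain ⟨a, ha⟩ := HeightOneSpectrum.mem_integers_of_valuation_le_one K ((x : Kˣ) : K)
      fun v => (hval v).le
    obtain ⟨b, hb⟩ := HeightOneSpectrum.mem_integers_of_valuation_le_one K (((x : Kˣ)⁻¹ : Kˣ) : K)
      fun v => by rw [Units.val_inv_eq_inv_val, map_inv₀, hval v, inv_one]
    have hab : a * b = 1 := by
      apply FaithfulSMul.algebraMap_injective (𝓞 K) K
      rw [map_mul, ha, hb, map_one, Units.mul_inv]
    refine ⟨Additive.ofMul (Units.mkOfMulEqOne a b hab), ?_⟩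
    apply Additive.toMul.injective
    apply Subtype.ext
    apply Units.ext
    exact ha

/-- Up to finite index every vector of exponents is attained, because the class group is finite. -/
theorem finrank_range_valuationVector :
    Module.finrank ℤ (LinearMap.range (valuationVector K T)) = T.card := by
  classical
  apply le_antisymm
  · refine (Submodule.finrank_le _).trans ?_
    simp
  choose x hx hx' using fun p : T => exists_units_valuation_ne_one K p.1
  let y (p : T) : Additive ((T : Set (HeightOneSpectrum (𝓞 K))).unit K) :=
    Additive.ofMul ⟨x p, fun v hv => hx' p v (by rintro rfl; exact hv p.2)⟩
  have hy (p q : T) : valuationVector K T (y p) q = 0 ↔ q ≠ p := by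
    rw [valuationVector_apply_eq_zero_iff]
    constructor
    · rintro h rfl
      exact hx q h
    · intro h
      exact hx' p q.1 fun h' => h (Subtype.ext h')
  have hli : LinearIndependent ℤ fun p => valuationVector K T (y p) := by
    rw [Fintype.linearIndependent_iff]
    intro g hg p
    have := congrFun hg p
    rw [Finset.sum_apply, Finset.sum_eq_single p] at this
    · exact (mul_eq_zero.1 this).resolve_right fun h => (hy p p).1 h rfl
    · intro q _ hq
      rw [Pi.smul_apply, (hy q p).2 hq.symm, smul_zero]
    · simp
  have := finrank_span_eq_card hli
  rw [Fintype.card_coe] at this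
  rw [← this]
  apply Submodule.finrank_mono
  rw [Submodule.span_le]
  rintro _ ⟨p, rfl⟩
  exact ⟨_, rfl⟩

instance finite_additive_unit :
    Module.Finite ℤ (Additive ((T : Set (HeightOneSpectrum (𝓞 K))).unit K)) := by
  rw [Module.finite_def]
  apply Submodule.fg_of_fg_map_of_fg_inf_ker (valuationVector K T)
  · exact IsNoetherian.noetherian _
  · rw [top_inf_eq, ← range_unitsToUnit, LinearMap.range_eq_map]
    exact Module.Finite.fg_top.map _

/-- The rank in Dirichlet's unit theorem for `T`-units. -/
theorem finrank_additive_unit :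
    Module.finrank ℤ (Additive ((T : Set (HeightOneSpectrum (𝓞 K))).unit K)) =
      Units.rank K + T.card := by
  rw [← Submodule.finrank_quotient_add_finrank (LinearMap.ker (valuationVector K T)),
    (valuationVector K T).quotKerEquivRange.finrank_eq, finrank_range_valuationVector,
    ← range_unitsToUnit, LinearMap.finrank_range_of_inj (unitsToUnit_injective K T),
    Units.finrank_eq, add_comm]

end Rank

/-! ### Finitely generated abelian groups modulo prime powers -/

/-- In a finitely generated abelian group without `l`-torsion, reducing modulo a power of `l` only
sees the free part. -/
theorem exists_surjective_ker_eq_range_pow {G : Type*} [CommGroup G]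
    [Module.Finite ℤ (Additive G)] {l : ℕ} (hl : l.Prime) (hG : ∀ x : G, x ^ l = 1 → x = 1)
    {m : ℕ} (hm : ∃ n : ℕ, m = l ^ n) :
    ∃ f : G →* Multiplicative (Fin (Module.finrank ℤ (Additive G)) → ZMod m),
      Function.Surjective f ∧ f.ker = (powMonoidHom m : G →* G).range := by
  obtain ⟨n, rfl⟩ := hm
  let tor : Submodule ℤ (Additive G) := Submodule.torsion ℤ (Additive G)
  have hrank : Module.finrank ℤ (Additive G ⧸ tor) = Module.finrank ℤ (Additive G) := 
    finrank_quotient_eq_of_le_torsion le_rfl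
  let b : Module.Basis (Fin (Module.finrank ℤ (Additive G))) ℤ (Additive G ⧸ tor) :=
    Module.finBasisOfFinrankEq ℤ _ hrank
  let g : Additive G →+ (Fin (Module.finrank ℤ (Additive G)) → ZMod (l ^ n)) :=
    ((Int.castAddHom (ZMod (l ^ n))).compLeft _).comp
      (b.equivFun.toLinearMap ∘ₗ tor.mkQ).toAddMonoidHom
  have hg (x : Additive G) (i) : g x i = ((b.equivFun (tor.mkQ x) i : ℤ) : ZMod (l ^ n)) := rfl
  refine ⟨AddMonoidHom.toMultiplicativeRight g, ?_, ?_⟩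
  · intro v
    choose w hw using fun i => ZMod.intCast_surjective (v.toAdd i)
    obtain ⟨x, hx⟩ := tor.mkQ_surjective (b.equivFun.symm w)
    refine ⟨x.toMul, Multiplicative.toAdd.injective (funext fun i => ?_)⟩
    change g x i = _
    rw [hg, hx, LinearEquiv.apply_symm_apply, hw]
  · ext x
    rw [MonoidHom.mem_ker, MonoidHom.mem_range]
    constructor
    · intro hx
      have hx' (i) :
          ∃ c : ℤ, b.equivFun (tor.mkQ (Additive.ofMul x)) i = ((l ^ n : ℕ) : ℤ) * c := by
        have : g (Additive.ofMul x) i = 0 := congrFun (congrArg Multiplicative.toAdd hx) i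
        rw [hg, ZMod.intCast_zmod_eq_zero_iff_dvd] at this
        exact this
      choose c hc using hx'
      obtain ⟨y, hy⟩ := tor.mkQ_surjective (b.equivFun.symm c)
      have hmem : Additive.ofMul x - (l ^ n) • y ∈ tor := by
        rw [← Submodule.ker_mkQ tor, LinearMap.mem_ker, map_sub, map_nsmul, hy, sub_eq_zero]
        apply b.equivFun.injective
        ext i
        rw [map_nsmul, LinearEquiv.apply_symm_apply, hc]
        simp
      -- A torsion element has order prime to `l`, hence is an `l ^ n`-th power.
      obtain ⟨t, ht⟩ : ∃ t : G, t ^ l ^ n = x / y.toMul ^ l ^ n := by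
        set z : G := x / y.toMul ^ l ^ n with hz
        have hfin : IsOfFinOrder z := by
          obtain ⟨⟨a, ha⟩, hza⟩ := (Submodule.mem_torsion_iff _).1 hmem
          rw [isOfFinOrder_iff_zpow_eq_one]
          exact ⟨a, nonZeroDivisors.ne_zero ha, hza⟩
        have hcop : (orderOf z).Coprime (l ^ n) := by
          apply Nat.Coprime.pow_right
          rw [Nat.coprime_comm, hl.coprime_iff_not_dvd]
          rintro ⟨k, hk⟩
          have h1 : z ^ k = 1 := hG _ (by rw [← pow_mul, mul_comm, ← hk, pow_orderOf_eq_one])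
          have hpos := hfin.orderOf_pos
          have hk0 : 0 < k := Nat.pos_of_ne_zero (by rintro rfl; omega)
          have := Nat.le_of_dvd hk0 (orderOf_dvd_of_pow_eq_one h1)
          have := hl.two_le
          nlinarith
        obtain ⟨j, hj⟩ := exists_pow_eq_self_of_coprime hcop.symm
        exact ⟨z ^ j, by rw [← pow_mul, mul_comm, pow_mul, hj]⟩
      exact ⟨t * y.toMul, by rw [powMonoidHom_apply, mul_pow, ht, div_mul_cancel]⟩
    · rintro ⟨y, rfl⟩
      rw [powMonoidHom_apply, map_pow]
      apply Multiplicative.toAdd.injective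
      ext i
      simp

/-! ### Roots of unity and descent of powers -/

section Descent

/-- A field without primitive `l`-th root of unity has no nontrivial root of unity of `l`-power
order. -/
theorem eq_one_of_pow_prime_pow_eq_one {E : Type*} [Field E] {l : ℕ} (hl : l.Prime)
    (hE : ¬ ∃ ζ : E, IsPrimitiveRoot ζ l) (n : ℕ) {x : E} (hx : x ^ l ^ n = 1) : x = 1 := by
  induction n with
  | zero => simpa using hx
  | succ n ih =>
    have h1 : (x ^ l ^ n) ^ l = 1 := by rw [← pow_mul, ← pow_succ, hx]
    apply ih
    by_contra hne
    have : Fact l.Prime := ⟨hl⟩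
    exact hE ⟨_, IsPrimitiveRoot.iff_orderOf.2 (orderOf_eq_prime h1 hne)⟩

/-- An automorphism of `l`-power order fixes `l`-th roots of unity, since `(ℤ/l)ˣ` has no elements
of order `l`. Hence a Galois `l`-extension contains no new `l`-th roots of unity. -/
theorem not_exists_isPrimitiveRoot_of_isPGroup {E F : Type*} [Field E] [Field F] [Algebra E F]
    [IsGalois E F] {l : ℕ} (hl : l.Prime) (hF : IsPGroup l Gal(F/E))
    (hE : ¬ ∃ ζ : E, IsPrimitiveRoot ζ l) : ¬ ∃ ζ : F, IsPrimitiveRoot ζ l := by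
  rintro ⟨ζ, hζ⟩
  have : Fact l.Prime := ⟨hl⟩
  have : NeZero l := ⟨hl.ne_zero⟩
  have hmod (i j : ℕ) : ζ ^ i = ζ ^ j ↔ (i : ZMod l) = (j : ZMod l) := by
    rw [(hζ.isOfFinOrder hl.ne_zero).pow_eq_pow_iff_modEq, ← hζ.eq_orderOf,
      ZMod.natCast_eq_natCast_iff]
  have hfix (σ : Gal(F/E)) : σ ζ = ζ := by
    obtain ⟨c, -, hc⟩ := hζ.eq_pow_of_pow_eq_one (ξ := σ ζ) (by
      rw [← map_pow, hζ.pow_eq_one, map_one])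
    obtain ⟨k, hk⟩ := hF σ
    have hiter (j : ℕ) : (σ ^ j) ζ = ζ ^ c ^ j := by
      induction j with
      | zero => simp
      | succ j ih => rw [pow_succ, AlgEquiv.mul_apply, ← hc, map_pow, ih, ← pow_mul, ← pow_succ]
    have h1 : ζ ^ c ^ l ^ k = ζ ^ 1 := by rw [← hiter, hk, AlgEquiv.one_apply, pow_one]
    -- `c ^ l ^ k = c` in `ZMod l` by Fermat's little theorem.
    have h2 : ((c ^ l ^ k : ℕ) : ZMod l) = ((1 : ℕ) : ZMod l) := by
      rwa [← hmod]
    have h3 : ((c : ℕ) : ZMod l) = ((1 : ℕ) : ZMod l) := by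
      rw [← h2, Nat.cast_pow, ZMod.pow_card_pow]
    rw [← hmod, pow_one] at h3
    rw [← hc, h3]
  obtain ⟨ξ, hξ⟩ := (InfiniteGalois.mem_range_algebraMap_iff_fixed ζ).2 hfix
  exact hE ⟨ξ, IsPrimitiveRoot.of_map_of_injective (f := algebraMap E F) (hξ ▸ hζ)
    (FaithfulSMul.algebraMap_injective E F)⟩

/-- If a Galois extension contains no nontrivial `m`-th root of unity, then an element of the base
field which becomes an `m`-th power already is one. -/
theorem exists_pow_eq_of_isGalois {E F : Type*} [Field E] [Field F] [Algebra E F]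
    [IsGalois E F] {m : ℕ} (hF : ∀ x : F, x ^ m = 1 → x = 1) {a : E} (ha : a ≠ 0) {b : F}
    (hb : b ^ m = algebraMap E F a) (hm : m ≠ 0) : ∃ c : E, c ^ m = a := by
  have hb0 : b ≠ 0 := by
    rintro rfl
    rw [zero_pow hm, eq_comm, map_eq_zero] at hb
    exact ha hb
  have hfix (σ : Gal(F/E)) : σ b = b := by
    have : σ b / b = 1 := hF _ (by
      rw [div_pow, ← map_pow, hb, AlgEquiv.commutes, div_self]
      simpa using ha)
    rwa [div_eq_one_iff_eq hb0] at this
  obtain ⟨c, rfl⟩ := (InfiniteGalois.mem_range_algebraMap_iff_fixed b).2 hfix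
  exact ⟨c, FaithfulSMul.algebraMap_injective E F (by rw [map_pow, hb])⟩

/-- Schinzel's argument. Let `F/E` be abelian, where `F` contains the `m`-th roots of unity, `m` is
a power of `l`, and `E` contains no primitive `l`-th root of unity. If `σ` acts on the `m`-th roots
of unity as raising to the power `c`, then for every `m`-th root `b` of `a : E` the quotient
`σ b / b ^ c` is fixed by the Galois group because `σ` commutes with everything. Thus
`a ^ (1 - c)` is an `m`-th power in `E`, and `σ` can be chosen with `c - 1` prime to `l`. -/
theorem exists_pow_eq_of_isAbelianGalois {E F : Type*} [Field E] [Field F] [Algebra E F]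
    [IsAbelianGalois E F] {l : ℕ} (hl : l.Prime) (hE : ¬ ∃ ζ : E, IsPrimitiveRoot ζ l)
    (n : ℕ) {ω : F} (hω : IsPrimitiveRoot ω (l ^ n)) {a : E} (ha : a ≠ 0) {b : F}
    (hb : b ^ l ^ n = algebraMap E F a) : ∃ c : E, c ^ l ^ n = a := by
  rcases n with - | n
  · exact ⟨a, by simp⟩
  set m : ℕ := l ^ (n + 1) with hm
  have hm0 : m ≠ 0 := pow_ne_zero _ hl.ne_zero
  have : NeZero m := ⟨hm0⟩
  have hb0 : b ≠ 0 := by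
    rintro rfl
    rw [zero_pow hm0, eq_comm, map_eq_zero] at hb
    exact ha hb
  have hω' : IsPrimitiveRoot (ω ^ l ^ n) l := hω.pow (Nat.pos_of_ne_zero hm0) (pow_succ l n)
  obtain ⟨σ, hσ⟩ : ∃ σ : Gal(F/E), σ (ω ^ l ^ n) ≠ ω ^ l ^ n := by
    by_contra! hfix
    obtain ⟨ξ, hξ⟩ := (InfiniteGalois.mem_range_algebraMap_iff_fixed (ω ^ l ^ n)).2 hfix
    exact hE ⟨ξ, IsPrimitiveRoot.of_map_of_injective (f := algebraMap E F) (hξ ▸ hω')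
      (FaithfulSMul.algebraMap_injective E F)⟩
  obtain ⟨c, -, hc⟩ := hω.eq_pow_of_pow_eq_one (ξ := σ ω) (by
    rw [← map_pow, hω.pow_eq_one, map_one])
  have hσc (ξ : F) (hξ : ξ ^ m = 1) : σ ξ = ξ ^ c := by
    obtain ⟨j, -, rfl⟩ := hω.eq_pow_of_pow_eq_one hξ
    rw [map_pow, ← hc, pow_right_comm]
  -- If `l` divided `c - 1`, then `σ` would fix the root of unity `ω ^ l ^ n` of order `l`.
  have hcop : IsCoprime (1 - (c : ℤ)) (m : ℤ) := by
    rw [hm, Nat.cast_pow]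
    apply IsCoprime.pow_right
    rw [isCoprime_comm, (Nat.prime_iff_prime_int.1 hl).coprime_iff_not_dvd]
    intro hdvd
    apply hσ
    rw [map_pow, ← hc, pow_right_comm, ← zpow_natCast (ω ^ l ^ n) c]
    have h1 : (ω ^ l ^ n) ^ (1 - (c : ℤ)) = 1 := (hω'.zpow_eq_one_iff_dvd _).2 hdvd
    rw [zpow_sub₀ (hω'.ne_zero hl.ne_zero), zpow_one, div_eq_one_iff_eq
      (zpow_ne_zero _ (hω'.ne_zero hl.ne_zero))] at h1
    exact h1.symm
  -- Writing `τ b = ξ * b`, both `σ b` and `b ^ c` are multiplied by `ξ ^ c` under `τ`.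
  have hfix (τ : Gal(F/E)) : τ (σ b / b ^ c) = σ b / b ^ c := by
    set ξ := τ b / b with hξ
    have hξm : ξ ^ m = 1 := by
      rw [hξ, div_pow, ← map_pow, hb, AlgEquiv.commutes, div_self]
      simpa using ha
    have hτ : τ b = ξ * b := by rw [hξ, div_mul_cancel₀ _ hb0]
    have hcomm : τ (σ b) = σ (τ b) := by
      rw [← AlgEquiv.mul_apply, (IsMulCommutative.is_comm (M := Gal(F/E))).comm τ σ,
        AlgEquiv.mul_apply]
    have hξ0 : ξ ≠ 0 := by
      rintro h
      rw [h, zero_pow hm0] at hξm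
      exact zero_ne_one hξm
    rw [map_div₀, map_pow, hcomm, hτ, map_mul, hσc ξ hξm, mul_pow,
      mul_div_mul_left _ _ (pow_ne_zero _ hξ0)]
  obtain ⟨d, hd⟩ := (InfiniteGalois.mem_range_algebraMap_iff_fixed _).2 hfix
  have hdm : d ^ m = a ^ (1 - (c : ℤ)) := by
    apply FaithfulSMul.algebraMap_injective E F
    rw [map_pow, hd, div_pow, ← map_pow, hb, AlgEquiv.commutes, pow_right_comm, hb, map_zpow₀,
      zpow_sub₀ (by simpa using ha), zpow_one, zpow_natCast]
  obtain ⟨u, v, huv⟩ := hcop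
  -- Bézout: `a = (a ^ (1 - c)) ^ u * (a ^ m) ^ v`.
  refine ⟨d ^ u * a ^ v, ?_⟩
  rw [mul_pow, ← zpow_natCast (d ^ u), ← zpow_mul, mul_comm u, zpow_mul, zpow_natCast, hdm,
    ← zpow_mul, ← zpow_natCast (a ^ v), ← zpow_mul, ← zpow_add₀ ha, mul_comm _ u, huv, zpow_one]

end Descent

/-! ### Kummer theory -/

section Kummer

variable {K Ω : Type*} [Field K] [Field Ω] [Algebra K Ω]

/-- The field generated over `F` by all `m`-th roots in `Ω` of the elements of a subgroup `H` of
`Kˣ`. -/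
noncomputable abbrev rootField (H : Subgroup Kˣ) (m : ℕ) (F : IntermediateField K Ω) :
    IntermediateField F Ω :=
  IntermediateField.adjoin F {x : Ω | ∃ a ∈ H, x ^ m = algebraMap K Ω (a : K)}

variable {H : Subgroup Kˣ} {m : ℕ} {F : IntermediateField K Ω}

theorem mem_rootField {x : Ω} {a : Kˣ} (ha : a ∈ H) (hx : x ^ m = algebraMap K Ω (a : K)) :
    x ∈ rootField H m F :=
  IntermediateField.subset_adjoin _ _ ⟨a, ha, hx⟩

theorem ne_zero_of_pow_eq (hm : m ≠ 0) {x : Ω} {a : Kˣ}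
    (hx : x ^ m = algebraMap K Ω (a : K)) : x ≠ 0 := by
  rintro rfl
  rw [zero_pow hm, eq_comm, map_eq_zero] at hx
  exact a.ne_zero hx

/-- The quotient `σ x / x` depends only on `x ^ m`, because `F` contains the `m`-th roots of
unity. -/
theorem map_div_self_eq_of_pow_eq (hF : ∀ ζ : Ω, ζ ^ m = 1 → ζ ∈ F)
    (σ : Gal(rootField H m F/F)) {x y : rootField H m F} (hx : x ≠ 0) (hy : y ≠ 0)
    (h : x ^ m = y ^ m) : σ x / x = σ y / y := by
  have h1 : ((x / y : rootField H m F) : Ω) ^ m = 1 := by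
    rw [← SubmonoidClass.coe_pow, div_pow, h, div_self (pow_ne_zero _ hy)]
    rfl
  have h2 : x / y = algebraMap F (rootField H m F) ⟨_, hF _ h1⟩ := rfl
  have h3 : σ (x / y) = x / y := by rw [h2, AlgEquiv.commutes]
  have hσy : σ y ≠ 0 := by simpa using hy
  rw [map_div₀, div_eq_div_iff hσy hy] at h3
  rw [div_eq_div_iff hx hy, h3, mul_comm]

/-- The Kummer character of an automorphism `σ`: it sends `a` to `σ x / x`, where `x` is any `m`-th
root of `a`. It kills `m`-th powers, hence factors through a surjection `q` whose kernel consists of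
them. -/
theorem exists_kummerCharacter [IsAlgClosed Ω] {A : Type*} [CommGroup A] {q : H →* A}
    (hq : Function.Surjective q) (hker : q.ker = (powMonoidHom m : H →* H).range) (hm : m ≠ 0)
    (hF : ∀ ζ : Ω, ζ ^ m = 1 → ζ ∈ F) (σ : Gal(rootField H m F/F)) :
    ∃ χ : A →* Ωˣ, ∀ (a : H) (x : rootField H m F),
      (x : Ω) ^ m = algebraMap K Ω (a : Kˣ) → (σ x : Ω) = χ (q a) * x := by
  choose r hr using fun a : H =>
    IsAlgClosed.exists_pow_nat_eq (algebraMap K Ω ((a : Kˣ) : K)) (Nat.pos_of_ne_zero hm)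
  let s (a : H) : rootField H m F := ⟨r a, mem_rootField a.2 (hr a)⟩
  have hs0 {x : rootField H m F} {a : H} (h : (x : Ω) ^ m = algebraMap K Ω (a : Kˣ)) : x ≠ 0 :=
    fun hx => ne_zero_of_pow_eq hm h (by rw [hx]; rfl)
  have key (a : H) (x : rootField H m F) (hx : (x : Ω) ^ m = algebraMap K Ω (a : Kˣ)) :
      σ x / x = σ (s a) / s a :=
    map_div_self_eq_of_pow_eq hF σ (hs0 hx) (hs0 (hr a)) (Subtype.ext (hx.trans (hr a).symm))
  let φ : H →* rootField H m F :=
    { toFun a := σ (s a) / s a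
      map_one' := by
        rw [← key 1 1 (by simp), map_one, div_one]
      map_mul' a b := by
        rw [← key (a * b) (s a * s b) (by simp [s, mul_pow, hr]), map_mul, mul_div_mul_comm] }
  let ψ : H →* Ωˣ := (((rootField H m F).val : rootField H m F →* Ω).comp φ).toHomUnits
  have hψ : q.ker ≤ ψ.ker := by
    rw [hker]
    rintro _ ⟨a, rfl⟩
    apply Units.ext
    have h1 : φ (powMonoidHom m a) = 1 := by
      change σ _ / _ = _
      rw [← key (powMonoidHom m a) (algebraMap F _ (algebraMap K F (a : Kˣ)))
        (map_pow (algebraMap K Ω) ((a : Kˣ) : K) m).symm, AlgEquiv.commutes, div_self]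
      simp
    change ((φ (powMonoidHom m a) : rootField H m F) : Ω) = 1
    rw [h1]
    rfl
  refine ⟨q.liftOfSurjective hq ⟨ψ, hψ⟩, fun a x hx => ?_⟩
  rw [MonoidHom.liftOfRightInverse_comp_apply]
  change (σ x : Ω) = ((σ (s a) / s a : rootField H m F) : Ω) * x
  rw [← key a x hx, ← MulMemClass.coe_mul, div_mul_cancel₀ _ (hs0 hx)]

/-- Two automorphisms, possibly over different base fields, with the same Kummer character agree on
common elements. -/
theorem apply_eq_of_forall_root {F' : IntermediateField K Ω} (hFF' : F ≤ F')
    (σ : Gal(rootField H m F/F)) (τ : Gal(rootField H m F'/F'))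
    (h : ∀ a ∈ H, ∀ (x : rootField H m F) (y : rootField H m F'),
      (x : Ω) ^ m = algebraMap K Ω (a : K) → (x : Ω) = y → (τ y : Ω) = σ x)
    (x : rootField H m F) (y : rootField H m F') (hxy : (x : Ω) = y) : (τ y : Ω) = σ x := by
  have main : ∀ (x : Ω) (hx : x ∈ rootField H m F), ∃ hx' : x ∈ rootField H m F',
      (τ ⟨x, hx'⟩ : Ω) = σ ⟨x, hx⟩ := by
    intro x hx
    induction hx using IntermediateField.adjoin_induction with
    | mem x hx =>
      obtain ⟨a, ha, hxa⟩ := hx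
      exact ⟨mem_rootField ha hxa, h a ha ⟨x, _⟩ ⟨x, _⟩ hxa rfl⟩
    | algebraMap z =>
      refine ⟨(algebraMap F' (rootField H m F') ⟨z, hFF' z.2⟩).2, ?_⟩
      have h1 := congrArg (fun w : rootField H m F' => (w : Ω)) (τ.commutes ⟨z, hFF' z.2⟩)
      have h2 := congrArg (fun w : rootField H m F => (w : Ω)) (σ.commutes z)
      exact h1.trans h2.symm
    | add x y hx hy ihx ihy =>
      obtain ⟨hx', ex⟩ := ihx
      obtain ⟨hy', ey⟩ := ihy
      refine ⟨add_mem hx' hy', ?_⟩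
      rw [← AddMemClass.mk_add_mk _ x y hx' hy', ← AddMemClass.mk_add_mk _ x y hx hy, map_add,
        map_add, AddMemClass.coe_add, AddMemClass.coe_add, ex, ey]
    | inv x hx ihx =>
      obtain ⟨hx', ex⟩ := ihx
      refine ⟨inv_mem hx', ?_⟩
      have h1 : (⟨x⁻¹, inv_mem hx'⟩ : rootField H m F') = (⟨x, hx'⟩)⁻¹ := rfl
      have h2 : (⟨x⁻¹, inv_mem hx⟩ : rootField H m F) = (⟨x, hx⟩)⁻¹ := rfl
      rw [h1, h2, map_inv₀, map_inv₀]
      exact congrArg _ ex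
    | mul x y hx hy ihx ihy =>
      obtain ⟨hx', ex⟩ := ihx
      obtain ⟨hy', ey⟩ := ihy
      refine ⟨mul_mem hx' hy', ?_⟩
      rw [← MulMemClass.mk_mul_mk _ x y hx' hy', ← MulMemClass.mk_mul_mk _ x y hx hy, map_mul,
        map_mul, MulMemClass.coe_mul, MulMemClass.coe_mul, ex, ey]
  obtain ⟨hx', e⟩ := main x x.2
  rw [← e]
  exact congrArg (fun z => (τ z : Ω)) (Subtype.ext hxy.symm)

/-- A conjugate of an `m`-th root of an element of `H` is again one, so the extension is normal. -/
theorem isGalois_rootField [IsAlgClosure K Ω] [CharZero K] : IsGalois F (rootField H m F) := by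
  have : IsAlgClosed Ω := IsAlgClosure.isAlgClosed K
  have : Algebra.IsAlgebraic K Ω := IsAlgClosure.isAlgebraic
  have : Algebra.IsAlgebraic F Ω := Algebra.IsAlgebraic.tower_top (K := K) F
  have : IsAlgClosure F Ω := ⟨inferInstance, inferInstance⟩
  have : CharZero F := charZero_of_injective_algebraMap (FaithfulSMul.algebraMap_injective K F)
  have : Normal F Ω := IsAlgClosure.normal F Ω
  have : Algebra.IsSeparable F (rootField H m F) := inferInstance
  have : Normal F (rootField H m F) := by
    rw [IntermediateField.normal_iff_forall_map_le]
    intro σ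
    rw [IntermediateField.adjoin_map]
    apply IntermediateField.adjoin.mono
    rintro _ ⟨x, ⟨a, ha, hx⟩, rfl⟩
    refine ⟨a, ha, ?_⟩
    rw [← map_pow, hx, IsScalarTower.algebraMap_apply K F Ω, AlgHom.commutes]
  exact ⟨⟩

/-- The Kummer pairing, as a homomorphism from the Galois group to the dual of a group `A` presented
as `H / H ^ m` by a surjection `q`. -/
noncomputable def kummerMap [IsAlgClosed Ω] {A : Type*} [CommGroup A] {q : H →* A}
    (hq : Function.Surjective q) (hker : q.ker = (powMonoidHom m : H →* H).range) (hm : m ≠ 0)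
    (hF : ∀ ζ : Ω, ζ ^ m = 1 → ζ ∈ F) :
    Gal(rootField H m F/F) →* (A →* Ωˣ) :=
  MonoidHom.mk' (fun σ => (exists_kummerCharacter hq hker hm hF σ).choose) fun σ τ => by
    ext a'
    obtain ⟨a, rfl⟩ := hq a'
    obtain ⟨x, hx⟩ :=
      IsAlgClosed.exists_pow_nat_eq (algebraMap K Ω ((a : Kˣ) : K)) (Nat.pos_of_ne_zero hm)
    let x' : rootField H m F := ⟨x, mem_rootField a.2 hx⟩
    have hx0 : x ≠ 0 := ne_zero_of_pow_eq hm hx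
    have hστ := (exists_kummerCharacter hq hker hm hF (σ * τ)).choose_spec a x' hx
    have hσ := (exists_kummerCharacter hq hker hm hF σ).choose_spec a (τ x') (by
      change ((τ x' ^ m : rootField H m F) : Ω) = _
      rw [← map_pow]
      have : x' ^ m = algebraMap F _ (algebraMap K F ((a : Kˣ) : K)) := Subtype.ext hx
      rw [this, AlgEquiv.commutes]
      rfl)
    have hτ := (exists_kummerCharacter hq hker hm hF τ).choose_spec a x' hx
    rw [AlgEquiv.mul_apply, hσ, hτ, ← mul_assoc] at hστ
    exact (mul_right_cancel₀ hx0 hστ).symm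

theorem kummerMap_spec [IsAlgClosed Ω] {A : Type*} [CommGroup A] {q : H →* A}
    (hq : Function.Surjective q) (hker : q.ker = (powMonoidHom m : H →* H).range) (hm : m ≠ 0)
    (hF : ∀ ζ : Ω, ζ ^ m = 1 → ζ ∈ F)
    (σ : Gal(rootField H m F/F)) (a : H) (x : rootField H m F)
    (hx : (x : Ω) ^ m = algebraMap K Ω (a : Kˣ)) :
    (σ x : Ω) = kummerMap hq hker hm hF σ (q a) * x :=
  (exists_kummerCharacter hq hker hm hF σ).choose_spec a x hx

theorem kummerMap_injective [IsAlgClosed Ω] {A : Type*} [CommGroup A] {q : H →* A}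
    (hq : Function.Surjective q) (hker : q.ker = (powMonoidHom m : H →* H).range) (hm : m ≠ 0)
    (hF : ∀ ζ : Ω, ζ ^ m = 1 → ζ ∈ F) :
    Function.Injective (kummerMap hq hker hm hF) := by
  intro σ τ h
  ext x
  refine apply_eq_of_forall_root le_rfl τ σ (fun a ha x y hx hxy => ?_) x x rfl
  obtain rfl := Subtype.ext hxy
  rw [kummerMap_spec hq hker hm hF σ ⟨a, ha⟩ x hx,
    kummerMap_spec hq hker hm hF τ ⟨a, ha⟩ x hx, h]

/-- A subgroup of the dual of a finite abelian group with trivial annihilator is everything. -/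
theorem eq_top_of_forall_apply_eq_one {A k : Type*} [CommGroup A] [Finite A] [Field k]
    [IsAlgClosed k] [CharZero k] {Φ : Subgroup (A →* kˣ)}
    (h : ∀ a : A, (∀ φ ∈ Φ, φ a = 1) → a = 1) : Φ = ⊤ := by
  let e := CommGroup.subgroupOrderIsoSubgroupMonoidHom A k
  have hbot : e.symm (OrderDual.toDual Φ) = ⊥ := by
    rw [eq_bot_iff]
    intro a ha
    rw [CommGroup.mem_subgroupOrderIsoSubgroupMonoidHom_symm_iff] at ha
    exact h a ha
  have htop := congrArg e hbot
  rw [OrderIso.apply_symm_apply, map_bot] at htop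
  exact htop

/-- If both Galois groups are the full dual of `H / H ^ m`, comparing Kummer characters gives an
isomorphism which inverts restriction of automorphisms. -/
theorem exists_mulEquiv_of_bijective_kummerMap [IsAlgClosed Ω] {A : Type*} [CommGroup A]
    {q : H →* A} (hq : Function.Surjective q) (hker : q.ker = (powMonoidHom m : H →* H).range)
    (hm : m ≠ 0) {F' : IntermediateField K Ω} (hFF' : F ≤ F') (hF : ∀ ζ : Ω, ζ ^ m = 1 → ζ ∈ F)
    (hF' : ∀ ζ : Ω, ζ ^ m = 1 → ζ ∈ F') (h : Function.Bijective (kummerMap hq hker hm hF))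
    (h' : Function.Bijective (kummerMap hq hker hm hF')) :
    ∃ f : Gal(rootField H m F/F) ≃* Gal(rootField H m F'/F'),
      ∀ (σ : Gal(rootField H m F/F)) (x : rootField H m F) (y : rootField H m F'),
        (x : Ω) = (y : Ω) → (f σ y : Ω) = (σ x : Ω) := by
  let e := MulEquiv.ofBijective _ h
  let e' := MulEquiv.ofBijective _ h'
  refine ⟨e.trans e'.symm, fun σ => apply_eq_of_forall_root hFF' σ _ fun a ha x y hx hxy => ?_⟩
  have he : kummerMap hq hker hm hF' (e.trans e'.symm σ) = kummerMap hq hker hm hF σ :=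
    e'.apply_symm_apply (e σ)
  rw [kummerMap_spec hq hker hm hF σ ⟨a, ha⟩ x hx,
    kummerMap_spec hq hker hm hF' _ ⟨a, ha⟩ y (hxy ▸ hx), he, hxy]

/-- Kummer theory: if an element of `H` is an `m`-th power in `F` only when it is one in `H`, then
the Galois group is the full dual of `H / H ^ m`. Indeed an element of `H / H ^ m` annihilated by
the whole Galois group has an `m`-th root in the fixed field `F`, so the annihilator of the image
is trivial. -/
theorem kummerMap_bijective [IsAlgClosure K Ω] [CharZero K] [IsAlgClosed Ω] {A : Type*}
    [CommGroup A] [Finite A] {q : H →* A} (hq : Function.Surjective q)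
    (hker : q.ker = (powMonoidHom m : H →* H).range) (hm : m ≠ 0)
    (hF : ∀ ζ : Ω, ζ ^ m = 1 → ζ ∈ F)
    (hH : ∀ a ∈ H, ∀ b ∈ F, b ^ m = algebraMap K Ω (a : K) → ∃ c ∈ H, c ^ m = a) :
    Function.Bijective (kummerMap hq hker hm hF) := by
  refine ⟨kummerMap_injective hq hker hm hF, ?_⟩
  have : CharZero Ω := charZero_of_injective_algebraMap (FaithfulSMul.algebraMap_injective K Ω)
  rw [← MonoidHom.range_eq_top]
  apply eq_top_of_forall_apply_eq_one
  intro a' ha'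
  obtain ⟨a, rfl⟩ := hq a'
  obtain ⟨x, hx⟩ :=
    IsAlgClosed.exists_pow_nat_eq (algebraMap K Ω ((a : Kˣ) : K)) (Nat.pos_of_ne_zero hm)
  let x' : rootField H m F := ⟨x, mem_rootField a.2 hx⟩
  have := isGalois_rootField (H := H) (m := m) (F := F)
  obtain ⟨b, hb⟩ := (InfiniteGalois.mem_range_algebraMap_iff_fixed (k := F) x').2 fun σ => by
    apply Subtype.ext
    rw [kummerMap_spec hq hker hm hF σ a x' hx, ha' _ ⟨σ, rfl⟩, Units.val_one, one_mul]
  have hbx : (b : Ω) = x := congrArg (fun z : rootField H m F => (z : Ω)) hb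
  obtain ⟨c, hc, hca⟩ := hH a a.2 b b.2 (by rw [hbx, hx])
  rw [← MonoidHom.mem_ker, hker]
  exact ⟨⟨c, hc⟩, Subtype.ext hca⟩

end Kummer

/-! ### `S`-units in the tower -/

/-- The `S`-unit theorem modulo `m`: since `K` has no `l`-torsion among its roots of unity, the
group of `S`-units modulo `m`-th powers is free over `ℤ/m` of rank `|S| - 1`. -/
theorem exists_surjective_sUnits_ker_eq {K : Type*} [Field K] [NumberField K]
    (S : Finset (Place K)) (hS : ∀ v : InfinitePlace K, Sum.inl v ∈ S) {l : ℕ} (hl : l.Prime)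
    (hζ : ¬ ∃ ζ : K, IsPrimitiveRoot ζ l) {m : ℕ} (hm : ∃ n : ℕ, m = l ^ n) :
    ∃ q : sUnits S →* Multiplicative (Fin (S.card - 1) → ZMod m), Function.Surjective q ∧
      q.ker = (powMonoidHom m : sUnits S →* sUnits S).range := by
  have hT : sUnits S = ((S.toRight : Set (HeightOneSpectrum (𝓞 K)))).unit K := by
    rw [sUnits]
    congr 1
    ext p
    simp
  have hcard : Units.rank K + S.toRight.card = S.card - 1 := by
    have h1 : S.toLeft = Finset.univ := Finset.eq_univ_iff_forall.2 fun v => by simpa using hS v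
    have h2 := Finset.card_toLeft_add_card_toRight (u := S)
    have h3 : 0 < Fintype.card (InfinitePlace K) := Fintype.card_pos
    rw [h1, Finset.card_univ] at h2
    rw [Units.rank]
    omega
  rw [hT, ← hcard, ← finrank_additive_unit]
  refine exists_surjective_ker_eq_range_pow hl (fun x hx => ?_) hm
  apply Subtype.ext
  apply Units.ext
  refine eq_one_of_pow_prime_pow_eq_one hl hζ 1 ?_
  rw [pow_one]
  exact congrArg
    (fun z : (S.toRight : Set (HeightOneSpectrum (𝓞 K))).unit K => ((z : Kˣ) : K)) hx

theorem mem_sUnits_of_pow_mem {K : Type*} [Field K] [NumberField K] {S : Finset (Place K)}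
    {m : ℕ} (hm : m ≠ 0) {a : Kˣ} (ha : a ^ m ∈ sUnits S) : a ∈ sUnits S := by
  intro v hv
  have h := ha v hv
  rw [Units.val_pow_eq_pow_val, map_pow] at h
  exact (pow_eq_one_iff_of_nonneg zero_le hm).1 h

theorem mem_adjoinMu {K Ω : Type*} [Field K] [Field Ω] [Algebra K Ω] {m : ℕ}
    {E : IntermediateField K Ω} {ζ : Ω} (hζ : ζ ^ m = 1) : ζ ∈ adjoinMu m E :=
  IntermediateField.subset_adjoin E _ hζ

theorem adjoinMu_mono {K Ω : Type*} [Field K] [Field Ω] [Algebra K Ω] (m : ℕ)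
    {E E' : IntermediateField K Ω} (h : E ≤ E') : adjoinMu m E ≤ adjoinMu m E' := by
  intro x hx
  change x ∈ IntermediateField.adjoin E {ζ : Ω | ζ ^ m = 1} at hx
  induction hx using IntermediateField.adjoin_induction with
  | mem x hx => exact mem_adjoinMu hx
  | algebraMap z =>
    exact (algebraMap E' (IntermediateField.adjoin E' {ζ : Ω | ζ ^ m = 1}) ⟨z, h z.2⟩).2
  | add x y _ _ hx hy => exact add_mem hx hy
  | inv x _ hx => exact inv_mem hx
  | mul x y _ _ hx hy => exact mul_mem hx hy

/-- An `S`-unit of `K` that becomes an `m`-th power in `M` is the `m`-th power of an `S`-unit of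
`K`. -/
theorem exists_sUnits_pow_eq {K Ω : Type*} [Field K] [NumberField K] [Field Ω] [Algebra K Ω]
    [IsAlgClosure K Ω] (S : Finset (Place K)) {l : ℕ} (hl : l.Prime)
    (hζ : ¬ ∃ ζ : K, IsPrimitiveRoot ζ l) {m : ℕ} (hm : ∃ n : ℕ, m = l ^ n)
    (L : IntermediateField K Ω) [IsGalois K L] (hL : IsPGroup l Gal(L/K))
    (M : IntermediateField L Ω) [IsAbelianGalois L M]
    (hM : adjoinMu m L ≤ M.restrictScalars K) {a : Kˣ} (ha : a ∈ sUnits S) {b : Ω} (hb : b ∈ M)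
    (hba : b ^ m = algebraMap K Ω (a : K)) : ∃ c ∈ sUnits S, c ^ m = a := by
  have hm0 : m ≠ 0 := by
    obtain ⟨n, rfl⟩ := hm
    exact pow_ne_zero _ hl.ne_zero
  have : IsAlgClosed Ω := IsAlgClosure.isAlgClosed K
  have : CharZero Ω := charZero_of_injective_algebraMap (FaithfulSMul.algebraMap_injective K Ω)
  have hL' : ¬ ∃ ζ : L, IsPrimitiveRoot ζ l := not_exists_isPrimitiveRoot_of_isPGroup hl hL hζ
  obtain ⟨d, hd⟩ : ∃ d : L, d ^ m = algebraMap K L (a : K) := by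
    have : NeZero m := ⟨hm0⟩
    obtain ⟨ω, hω⟩ := HasEnoughRootsOfUnity.exists_primitiveRoot Ω m
    have hω' : IsPrimitiveRoot (⟨ω, hM (mem_adjoinMu hω.pow_eq_one)⟩ : M) m :=
      IsPrimitiveRoot.of_map_of_injective (f := algebraMap M Ω) hω
        (FaithfulSMul.algebraMap_injective M Ω)
    obtain ⟨n, rfl⟩ := hm
    exact exists_pow_eq_of_isAbelianGalois hl hL' n hω' (by simp) (b := ⟨b, hb⟩)
      (Subtype.ext hba)
  obtain ⟨c, hc⟩ := exists_pow_eq_of_isGalois (fun x hx => by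
    obtain ⟨n, rfl⟩ := hm
    exact eq_one_of_pow_prime_pow_eq_one hl hL' n hx) a.ne_zero hd hm0
  have hc0 : c ≠ 0 := by
    rintro rfl
    rw [zero_pow hm0] at hc
    exact a.ne_zero hc.symm
  have hca : Units.mk0 c hc0 ^ m = a := Units.ext hc
  exact ⟨Units.mk0 c hc0, mem_sUnits_of_pow_mem hm0 (hca ▸ ha), hca⟩

end SUnitKummer

theorem mainTheorem11 {K Ω : Type*} [Field K] [NumberField K] [Field Ω] [Algebra K Ω]
    [IsAlgClosure K Ω]
    (S : Finset (SUnitKummer.Place K)) (hS : ∀ v : InfinitePlace K, Sum.inl v ∈ S)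
    (l : ℕ) (hl : l.Prime) (hζ : ¬ ∃ ζ : K, IsPrimitiveRoot ζ l)
    (m : ℕ) (hm : ∃ n : ℕ, m = l ^ n)
    (L : IntermediateField K Ω) [IsGalois K L] (hL : IsPGroup l Gal(L/K))
    (M : IntermediateField L Ω) [IsAbelianGalois L M]
    (hM : SUnitKummer.adjoinMu m L ≤ M.restrictScalars K) :
    -- `Kt = K(μ_m)`, `Lt = L(μ_m)`, and `M'` is `M` regarded as an extension of `K`
    let Kt : IntermediateField K Ω := SUnitKummer.adjoinMu m ⊥
    let Lt : IntermediateField K Ω := SUnitKummer.adjoinMu m L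
    let M' : IntermediateField K Ω := M.restrictScalars K
    let RK : IntermediateField Kt Ω := SUnitKummer.adjoinRoots S m Kt
    let RL : IntermediateField Lt Ω := SUnitKummer.adjoinRoots S m Lt
    let RM : IntermediateField M' Ω := SUnitKummer.adjoinRoots S m M'
    -- the isomorphisms are inverse to restriction of automorphisms
    (∃ f₁ : Gal(RK/Kt) ≃* Gal(RL/Lt), ∀ (σ : Gal(RK/Kt)) (x : RK) (y : RL),
        (x : Ω) = (y : Ω) → (f₁ σ y : Ω) = (σ x : Ω)) ∧
    (∃ f₂ : Gal(RL/Lt) ≃* Gal(RM/M'), ∀ (σ : Gal(RL/Lt)) (x : RL) (y : RM),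
        (x : Ω) = (y : Ω) → (f₂ σ y : Ω) = (σ x : Ω)) ∧
    Nonempty (Gal(RM/M') ≃* Multiplicative (Fin (S.card - 1) → ZMod m)) := by
  intro Kt Lt M' RK RL RM
  have hm0 : m ≠ 0 := by
    obtain ⟨n, rfl⟩ := hm
    exact pow_ne_zero _ hl.ne_zero
  have : NeZero m := ⟨hm0⟩
  have : IsAlgClosed Ω := IsAlgClosure.isAlgClosed K
  have : CharZero Ω := charZero_of_injective_algebraMap (FaithfulSMul.algebraMap_injective K Ω)
  have hKL : Kt ≤ Lt := SUnitKummer.adjoinMu_mono m bot_le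
  have hμK (ζ : Ω) (h : ζ ^ m = 1) : ζ ∈ Kt := SUnitKummer.mem_adjoinMu h
  have hμL (ζ : Ω) (h : ζ ^ m = 1) : ζ ∈ Lt := SUnitKummer.mem_adjoinMu h
  have hμM (ζ : Ω) (h : ζ ^ m = 1) : ζ ∈ M' := hM (hμL ζ h)
  obtain ⟨q, hq, hker⟩ := SUnitKummer.exists_surjective_sUnits_ker_eq S hS hl hζ hm
  have hpow : ∀ a ∈ SUnitKummer.sUnits S, ∀ b ∈ M', b ^ m = algebraMap K Ω (a : K) →
      ∃ c ∈ SUnitKummer.sUnits S, c ^ m = a := fun a ha b hb hba =>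
    SUnitKummer.exists_sUnits_pow_eq S hl hζ hm L hL M hM ha hb hba
  -- `adjoinRoots S m` unfolds to `rootField (sUnits S) m`.
  have bK := SUnitKummer.kummerMap_bijective hq hker hm0 hμK
    fun a ha b hb => hpow a ha b (hM (hKL hb))
  have bL := SUnitKummer.kummerMap_bijective hq hker hm0 hμL fun a ha b hb => hpow a ha b (hM hb)
  have bM := SUnitKummer.kummerMap_bijective hq hker hm0 hμM hpow
  refine ⟨SUnitKummer.exists_mulEquiv_of_bijective_kummerMap hq hker hm0 hKL hμK hμL bK bL,
    SUnitKummer.exists_mulEquiv_of_bijective_kummerMap hq hker hm0 hM hμL hμM bL bM, ?_⟩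
  have e := MulEquiv.ofBijective _ bM
  exact ⟨e.trans (CommGroup.monoidHom_mulEquiv_of_hasEnoughRootsOfUnity
    (Multiplicative (Fin (S.card - 1) → ZMod m)) Ω).some⟩
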